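/- Let $K/F$ be a finite Galois extension of number fields with Galois group $G$. Let $M_F$ be the set of all (finite and infinite) places of $F$, and for each $v\in M_F$ fix a place $w$ of $K$ above $v$; let $F_v$ and $K_w$ be the completions, $G_w=\mathrm{Gal}(K_w/F_v)$, $G_F=\mathrm{Gal}(\overline F/F)$ and $G_{F_v}=\mathrm{Gal}(\overline{F_v}/F_v)$, where $\overline F$ and $\overline{F_v}$ are algebraic closures. Let $U_K=\mathcal O_K^\times$ and let $U_{\overline F}$ be the group of units of the ring of all algebraic integers in $\overline F$. For finite $v$ let $U_{K_w}$ and $U_{\overline F_v}$ be the groups of units of the valuation rings of $K_w$ and $\overline{F_v}$; for infinite $v$ put $U_{K_w}=K_w^\times$ and $U_{\overline F_v}=\overline{F_v}^{\times}$. All cohomology groups are continuous cohomology groups with discrete coefficients. Consider the localization maps $$\overline{\mathcal F}:H^1(G,U_K)\to\bigoplus_{v\in M_F}H^1(G_w,U_{K_w}),\qquad \overline{\mathcal G}:H^1(G_F,U_{\overline F})\to\bigoplus_{v\in M_F}H^1(G_{F_v},U_{\overline F_v}).$$ The inflation maps $H^1(G,U_K)\to H^1(G_F,U_{\overline F})$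 and $\bigoplus_v H^1(G_w,U_{K_w})\to\bigoplus_v H^1(G_{F_v},U_{\overline F_v})$ form a commutative square with $\overline{\mathcal F}$ and $\overline{\mathcal G}$, and hence induce a homomorphism $$\overline{\mathcal I}:\mathrm{Coker}(\overline{\mathcal F})\to\mathrm{Coker}(\overline{\mathcal G}).$$ Then $\overline{\mathcal I}$ is the zero map. (This holds for every choice of the places $w$ and of the embeddings $K\to\overline F$ over $F$, $\overline F\to\overline{F_v}$ over $F$ and $K_w\to\overline{F_v}$ over $F_v$ used to define these maps.) -/

import Mathlib

open NumberField IsDedekindDomain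

namespace UnitCohomology

section CohomologyOne

/-- Continuous `1`-cocycles (crossed homomorphisms) of `Gal(E/k)`, with its Krull topology, with
values in a (discrete) Galois-stable group `U` of nonzero elements of `E`. If `E/k` is finite the
topology is discrete and the continuity condition is void. -/
def cocycles (k : Type*) {E : Type*} [Field k] [Field E] [Algebra k E] (U : Subgroup Eˣ) :
    Subgroup (Gal(E/k) → Eˣ) where
  carrier := {c | (∀ σ, c σ ∈ U) ∧ IsLocallyConstant c ∧ groupCohomology.IsMulCocycle₁ c}
  one_mem' := ⟨fun _ => U.one_mem, IsLocallyConstant.const 1, fun _ _ => by simp⟩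
  mul_mem' {a b} ha hb := ⟨fun σ => U.mul_mem (ha.1 σ) (hb.1 σ), ha.2.1.mul hb.2.1, fun σ τ => by
    simp only [Pi.mul_apply, ha.2.2 σ τ, hb.2.2 σ τ, smul_mul', mul_mul_mul_comm]⟩
  inv_mem' {a} ha := ⟨fun σ => U.inv_mem (ha.1 σ), ha.2.1.inv, fun σ τ => by
    simp only [Pi.inv_apply, ha.2.2 σ τ, smul_inv', mul_inv]⟩

/-- Functions `σ ↦ σ(u)/u` with `u` in `U`. -/
def coboundaries (k : Type*) {E : Type*} [Field k] [Field E] [Algebra k E] (U : Subgroup Eˣ) :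
    Subgroup (Gal(E/k) → Eˣ) where
  carrier := {c | ∃ u ∈ U, ∀ σ : Gal(E/k), c σ = σ • u / u}
  one_mem' := ⟨1, U.one_mem, fun _ => by simp⟩
  mul_mem' := by
    rintro a b ⟨u, hu, hua⟩ ⟨v, hv, hvb⟩
    exact ⟨u * v, U.mul_mem hu hv, fun σ => by
      simp only [Pi.mul_apply, hua, hvb, smul_mul', mul_div_mul_comm]⟩
  inv_mem' := by
    rintro a ⟨u, hu, hua⟩
    exact ⟨u⁻¹, U.inv_mem hu, fun σ => by
      simp only [Pi.inv_apply, hua, smul_inv', div_eq_mul_inv, mul_comm, inv_inv, mul_inv]⟩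

/-- The continuous cohomology group `H¹(Gal(E/k), U)`, written multiplicatively. -/
def MulH1 (k : Type*) {E : Type*} [Field k] [Field E] [Algebra k E] (U : Subgroup Eˣ) : Type _ :=
  cocycles k U ⧸ (coboundaries k U).subgroupOf (cocycles k U)

instance (k : Type*) {E : Type*} [Field k] [Field E] [Algebra k E] (U : Subgroup Eˣ) :
    CommGroup (MulH1 k U) :=
  inferInstanceAs (CommGroup (cocycles k U ⧸ (coboundaries k U).subgroupOf (cocycles k U)))

/-- The continuous cohomology group `H¹(Gal(E/k), U)`, written additively. -/
abbrev H1 (k : Type*) {E : Type*} [Field k] [Field E] [Algebra k E] (U : Subgroup Eˣ) : Type _ :=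
  Additive (MulH1 k U)

/-- The class of a cocycle. -/
def H1.mk {k E : Type*} [Field k] [Field E] [Algebra k E] {U : Subgroup Eˣ} (c : cocycles k U) :
    H1 k U :=
  Additive.ofMul (QuotientGroup.mk c : cocycles k U ⧸ (coboundaries k U).subgroupOf (cocycles k U))

variable {k k' E L : Type*} [Field k] [Field k'] [Field E] [Field L] [Algebra k E] [Algebra k k']
  [Algebra k' L] [Algebra k L] [IsScalarTower k k' L]

/-- For an embedding `f : E → L` over `k → k'` with `E/k` normal, the restriction homomorphism
`Gal(L/k') → Gal(E/k)` along `f`. -/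
noncomputable def galRestrict [Normal k E] (f : E →ₐ[k] L) : Gal(L/k') →* Gal(E/k) :=
  letI : Algebra E L := f.toRingHom.toAlgebra
  haveI : IsScalarTower k E L := .of_algebraMap_eq fun x => (f.commutes x).symm
  (AlgEquiv.restrictNormalHom E).comp (AlgEquiv.restrictScalarsHom k)

theorem galRestrict_spec [Normal k E] (f : E →ₐ[k] L) (σ : Gal(L/k')) (x : E) :
    f (galRestrict f σ x) = σ (f x) := by
  let _ : Algebra E L := f.toRingHom.toAlgebra
  have : IsScalarTower k E L := .of_algebraMap_eq fun x => (f.commutes x).symm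
  exact AlgEquiv.restrictNormal_commutes (σ.restrictScalars k) E x

theorem galRestrict_smul [Normal k E] (f : E →ₐ[k] L) (σ : Gal(L/k')) (u : Eˣ) :
    Units.map (f : E →* L) (galRestrict f σ • u) = σ • Units.map (f : E →* L) u := by
  ext
  exact galRestrict_spec f σ u

theorem continuous_galRestrict [Normal k E] (f : E →ₐ[k] L) :
    Continuous (galRestrict f : Gal(L/k') → Gal(E/k)) := by
  refine continuous_of_continuousAt_one (galRestrict (k' := k') f) fun s hs => ?_
  rw [map_one, krullTopology_mem_nhds_one_iff] at hs
  obtain ⟨M, hM, hMs⟩ := hs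
  rw [Filter.mem_map, krullTopology_mem_nhds_one_iff]
  let b := Module.finBasis k M
  refine ⟨IntermediateField.adjoin k' (Set.range fun i => f (b i)), ?_, fun σ hσ => hMs ?_⟩
  · exact IntermediateField.finiteDimensional_adjoin fun x hx => by
      obtain ⟨i, rfl⟩ := hx
      have h1 : IsIntegral k ((b i : E)) :=
        (IntermediateField.isIntegral_iff.1 (Algebra.IsIntegral.isIntegral (R := k) (b i)))
      exact (h1.map f).tower_top
  · rw [SetLike.mem_coe, IntermediateField.mem_fixingSubgroup_iff] at hσ ⊢
    intro x hx
    apply f.injective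
    change f (galRestrict f σ x) = f x
    rw [galRestrict_spec]
    have : (⟨x, hx⟩ : M) = _ := (b.sum_repr ⟨x, hx⟩).symm
    have h2 : x = ∑ i, b.repr ⟨x, hx⟩ i • (b i : E) :=
      (congrArg (algebraMap M E) this).trans (map_sum _ _ _)
    rw [h2, map_sum, map_sum]
    refine Finset.sum_congr rfl fun i _ => ?_
    rw [map_smul, ← algebraMap_smul k', map_smul]
    congr 1
    exact hσ _ (IntermediateField.subset_adjoin _ _ ⟨i, rfl⟩)

/-- For an embedding `f : E → L` over `k → k'` with `E/k` normal and `f(U) ⊆ V`, the map of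
cocycles `c ↦ (τ ↦ f(c(τ|_E)))`. -/
noncomputable def cocyclesMap [Normal k E] (f : E →ₐ[k] L) (U : Subgroup Eˣ) (V : Subgroup Lˣ)
    (hUV : U ≤ V.comap (Units.map (f : E →* L))) : cocycles k U →* cocycles k' V where
  toFun c := ⟨fun τ => Units.map (f : E →* L) (c.1 (galRestrict f τ)),
    fun τ => hUV (c.2.1 _), (c.2.2.1.comp_continuous (continuous_galRestrict f)).comp _,
    fun σ τ => by
      simp only [map_mul, c.2.2.2 (galRestrict f σ) (galRestrict f τ), galRestrict_smul]⟩
  map_one' := by ext; simp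
  map_mul' a b := by ext; simp

/-- The map `H¹(Gal(E/k), U) → H¹(Gal(L/k'), V)` induced by an embedding `f : E → L` over `k → k'`
with `E/k` normal and `f(U) ⊆ V`. -/
noncomputable def H1.map [Normal k E] (f : E →ₐ[k] L) (U : Subgroup Eˣ) (V : Subgroup Lˣ)
    (hUV : U ≤ V.comap (Units.map (f : E →* L))) : H1 k U →+ H1 k' V :=
  MonoidHom.toAdditive (α := MulH1 k U) (β := MulH1 k' V) <| QuotientGroup.map ((coboundaries k U).subgroupOf (cocycles k U))
    ((coboundaries k' V).subgroupOf (cocycles k' V)) (cocyclesMap f U V hUV) (by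
      rintro ⟨c, hc⟩ ⟨u, hu, h⟩
      refine ⟨Units.map (f : E →* L) u, hUV hu, fun σ => ?_⟩
      have h1 : c (galRestrict f σ) = galRestrict f σ • u / u := h _
      change Units.map (f : E →* L) (c (galRestrict f σ)) = _
      rw [h1, map_div, galRestrict_smul])

theorem H1.map_mk [Normal k E] (f : E →ₐ[k] L) (U : Subgroup Eˣ) (V : Subgroup Lˣ)
    (hUV : U ≤ V.comap (Units.map (f : E →* L))) (c : cocycles k U) :
    (H1.map f U V hUV (H1.mk c) : H1 k' V) = H1.mk (cocyclesMap f U V hUV c) := rfl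

theorem exists_eq_smul_div {F E : Type*} [Field F] [Field E] [Algebra F E] [IsGalois F E]
    (c : Gal(E/F) → Eˣ) (hc : IsLocallyConstant c) (hcc : groupCohomology.IsMulCocycle₁ c) :
    ∃ y : Eˣ, ∀ σ : Gal(E/F), c σ = σ • y / y := by
  have h1 : c 1 = 1 := groupCohomology.map_one_of_isMulCocycle₁ hcc
  have hn : {σ | c σ = 1} ∈ nhds (1 : Gal(E/F)) :=
    (hc.isOpen_fiber 1).mem_nhds h1
  rw [krullTopology_mem_nhds_one_iff_of_normal] at hn
  obtain ⟨M, hM, hMn, hMs⟩ := hn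
  have : IsGalois F M := { }
  have hr (σ : Gal(E/F)) (τ : Gal(E/F)) (hτ : τ ∈ M.fixingSubgroup) : c (σ * τ) = c σ := by
    rw [hcc, (hMs hτ : c τ = 1), smul_one, one_mul]
  have hl (σ : Gal(E/F)) (τ : Gal(E/F)) (hτ : τ ∈ M.fixingSubgroup) : τ • c σ = c σ := by
    have h2 : c (τ * σ) = τ • c σ := by rw [hcc, (hMs hτ : c τ = 1), mul_one]
    have h3 : τ * σ = σ * (σ⁻¹ * τ * σ) := by group
    rw [← h2, h3, hr]
    have := (inferInstance : M.fixingSubgroup.Normal).conj_mem τ hτ σ⁻¹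
    simpa using this
  have hM' (σ : Gal(E/F)) : (c σ : E) ∈ M := by
    rw [← InfiniteGalois.fixedField_fixingSubgroup M, IntermediateField.mem_fixedField_iff]
    exact fun τ hτ => congrArg Units.val (hl σ τ hτ)
  let π : Gal(E/F) →* Gal(M/F) := AlgEquiv.restrictNormalHom M
  obtain ⟨s, hs⟩ : ∃ s : Gal(M/F) → Gal(E/F), ∀ g, π (s g) = g :=
    (AlgEquiv.restrictNormalHom_surjective E).hasRightInverse
  have hπ (σ τ : Gal(E/F)) (h : π σ = π τ) : c σ = c τ := by
    have h4 : τ⁻¹ * σ ∈ M.fixingSubgroup := by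
      rw [← IntermediateField.restrictNormalHom_ker, MonoidHom.mem_ker, map_mul, map_inv]
      exact (inv_mul_eq_one).2 h.symm
    rw [← hr τ _ h4, mul_inv_cancel_left]
  let c₀ : Gal(M/F) → Mˣ := fun g => Units.mk0 ⟨c (s g), hM' _⟩ fun h =>
    (c (s g)).ne_zero (congrArg Subtype.val h)
  have hs' (g : Gal(M/F)) (x : M) : ((g x : M) : E) = s g x := by
    conv_lhs => rw [← hs g]
    exact AlgEquiv.restrictNormal_commutes (s g) M x
  have hc₀ : groupCohomology.IsMulCocycle₁ c₀ := fun g h => by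
    ext
    have h5 : c (s (g * h)) = c (s g * s h) := hπ _ _ (by rw [map_mul, hs, hs, hs])
    rw [hcc] at h5
    have h6 := congrArg Units.val h5
    refine h6.trans ?_
    change s g (c (s h)) * c (s g) = ((g (⟨c (s h), hM' _⟩ : M) : M) : E) * c (s g)
    rw [hs']
  obtain ⟨β, hβ⟩ := groupCohomology.isMulCoboundary₁_of_isMulCocycle₁_of_aut_to_units c₀ hc₀
  refine ⟨Units.map (algebraMap M E : M →* E) β, fun σ => ?_⟩
  have h7 := congrArg (Units.map (algebraMap M E : M →* E)) (hβ (π σ))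
  rw [map_div] at h7
  have h8 : Units.map (algebraMap M E : M →* E) (c₀ (π σ)) = c σ := by
    rw [hπ σ (s (π σ)) (hs _).symm]
    ext
    rfl
  rw [← h8, ← h7]
  congr 1
  ext
  exact AlgEquiv.restrictNormal_commutes σ M (β : M)
end CohomologyOne

theorem normal_of_denseRange {F K k E : Type*} [Field F] [Field K] [Algebra F K]
    [FiniteDimensional F K] [Normal F K] [NontriviallyNormedField k] [CompleteSpace k]
    [Field E] [TopologicalSpace E] [IsTopologicalAddGroup E] [T2Space E] [Algebra k E]
    [ContinuousSMul k E] [Algebra F k] [Algebra F E] [IsScalarTower F k E] [Algebra K E]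
    [IsScalarTower F K E] (h : DenseRange (algebraMap K E)) : Normal k E := by
  obtain ⟨p, hp⟩ := Normal.exists_isSplittingField F K
  have hsp : ((p.map (algebraMap F k)).map (algebraMap k E)).Splits := by
    rw [Polynomial.map_map, ← IsScalarTower.algebraMap_eq, IsScalarTower.algebraMap_eq F K E,
      ← Polynomial.map_map]
    exact hp.splits.map _
  have hroot : Algebra.adjoin k ((p.map (algebraMap F k)).rootSet E) = ⊤ := by
    rw [eq_top_iff]
    set A := Algebra.adjoin k ((p.map (algebraMap F k)).rootSet E)
    have hK : ∀ x : K, algebraMap K E x ∈ A := by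
      intro x
      have hx : x ∈ Algebra.adjoin F (p.rootSet K) := by rw [hp.adjoin_rootSet]; trivial
      induction hx using Algebra.adjoin_induction with
      | mem x hx =>
        refine Algebra.subset_adjoin ?_
        rw [Polynomial.mem_rootSet'] at hx ⊢
        refine ⟨?_, ?_⟩
        · rw [Polynomial.map_map, ← IsScalarTower.algebraMap_eq]
          exact (Polynomial.map_ne_zero_iff (algebraMap F E).injective).2 fun h0 => by simp [h0] at hx
        · rw [Polynomial.aeval_map_algebraMap, Polynomial.aeval_algebraMap_apply, hx.2, map_zero]
      | algebraMap r =>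
        rw [← IsScalarTower.algebraMap_apply, IsScalarTower.algebraMap_apply F k E]
        exact A.algebraMap_mem _
      | add x y _ _ hx hy => rw [map_add]; exact A.add_mem hx hy
      | mul x y _ _ hx hy => rw [map_mul]; exact A.mul_mem hx hy
    let b := Module.finBasis F K
    let S : Submodule k E := Submodule.span k (Set.range fun i => algebraMap K E (b i))
    have : FiniteDimensional k S := FiniteDimensional.span_of_finite k (Set.finite_range _)
    have hS : ∀ x : K, algebraMap K E x ∈ S := fun x => by
      rw [← b.sum_repr x, map_sum]
      refine S.sum_mem fun i _ => ?_
      rw [Algebra.smul_def, map_mul, ← IsScalarTower.algebraMap_apply,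
        IsScalarTower.algebraMap_apply F k E, ← Algebra.smul_def]
      exact S.smul_mem _ (Submodule.subset_span ⟨i, rfl⟩)
    have hd : Dense (S : Set E) := h.mono (by rintro _ ⟨x, rfl⟩; exact hS x)
    have htop : (S : Set E) = Set.univ := by
      rw [← S.closed_of_finiteDimensional.closure_eq, hd.closure_eq]
    intro x _
    have hx : x ∈ S := by rw [← SetLike.mem_coe, htop]; trivial
    exact Submodule.span_le (p := A.toSubmodule).2 (by rintro _ ⟨i, rfl⟩; exact hK _) hx
  have := Polynomial.IsSplittingField.mk hsp hroot
  exact Normal.of_isSplittingField (p.map (algebraMap F k))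

section Spectral

open scoped Valued

/-- In an algebraic extension `L` of `F_v`, the integral closure of the valuation ring of `F_v` is the
valuation ring of `L`, for the unique extension of the absolute value. -/
theorem adic_isIntegral_iff_spectralNorm {F : Type*} [Field F] [NumberField F]
    (v : HeightOneSpectrum (𝓞 F)) {L : Type*} [Field L] [Algebra (v.adicCompletion F) L]
    [Algebra.IsAlgebraic (v.adicCompletion F) L]
    [Algebra (v.adicCompletionIntegers F) L]
    [IsScalarTower (v.adicCompletionIntegers F) (v.adicCompletion F) L] (x : L) :
    IsIntegral (v.adicCompletionIntegers F) x ↔ spectralNorm (v.adicCompletion F) L x ≤ 1 := by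
  have hx : IsIntegral (v.adicCompletion F) x := Algebra.IsIntegral.isIntegral x
  have hmem (a : v.adicCompletion F) : ‖a‖ ≤ 1 ↔ a ∈ v.adicCompletionIntegers F := by
    rw [Valued.toNormedField.norm_le_one_iff]; rfl
  rw [spectralNorm, spectralValue_le_one_iff (minpoly.monic hx)]
  refine ⟨fun h n => ?_, fun h => ?_⟩
  · rw [minpoly.isIntegrallyClosed_eq_field_fractions' (v.adicCompletion F) h, hmem,
      Polynomial.coeff_map]
    exact Subtype.property _
  · have hl : minpoly (v.adicCompletion F) x ∈
        Polynomial.lifts (algebraMap (v.adicCompletionIntegers F) (v.adicCompletion F)) := by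
      rw [Polynomial.lifts_iff_coeff_lifts]
      exact fun n => ⟨⟨_, (hmem _).1 (h n)⟩, rfl⟩
    obtain ⟨q, hq, -, hm⟩ :=
      Polynomial.lifts_and_natDegree_eq_and_monic hl (minpoly.monic hx)
    refine ⟨q, hm, ?_⟩
    have := minpoly.aeval (v.adicCompletion F) x
    rw [← hq, Polynomial.aeval_map_algebraMap] at this
    exact this

end Spectral

section Completions

variable {F K : Type*} [Field F] [NumberField F] [Field K] [NumberField K] [Algebra F K]

/-- For a finite place `w` of `K` over a finite place `v` of `F`, the continuous extension
`F_v → K_w` of the inclusion `F → K`. -/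
noncomputable def adicMap (v : HeightOneSpectrum (𝓞 F)) (w : HeightOneSpectrum (𝓞 K))
    [w.asIdeal.LiesOver v.asIdeal] : v.adicCompletion F →+* w.adicCompletion K :=
  ((HeightOneSpectrum.adicCompletion.equiv K w).symm.toRingHom.comp
    (UniformSpace.Completion.mapRingHom
      (algebraMap (WithVal (v.valuation F)) (WithVal (w.valuation K)))
      (HeightOneSpectrum.uniformContinuous_algebraMap_liesOver F K v w).continuous)).comp
    (HeightOneSpectrum.adicCompletion.equiv F v).toRingHom

variable (v : HeightOneSpectrum (𝓞 F)) (w : HeightOneSpectrum (𝓞 K))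
  [w.asIdeal.LiesOver v.asIdeal]

/-- `K_w` as an `F_v`-algebra. -/
noncomputable scoped instance adicAlgebra : Algebra (v.adicCompletion F) (w.adicCompletion K) :=
  (adicMap v w).toAlgebra

theorem continuous_adicMap : Continuous (adicMap v w) :=
  (HeightOneSpectrum.adicCompletion.continuous_ofCompletion K w).comp
    (UniformSpace.Completion.continuous_map.comp
      (HeightOneSpectrum.adicCompletion.continuous_toCompletion F v))

theorem adicMap_algebraMap (x : F) :
    adicMap v w (algebraMap F (v.adicCompletion F) x) =
      algebraMap F (w.adicCompletion K) x := by
  apply HeightOneSpectrum.adicCompletion.ext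
  exact UniformSpace.Completion.mapRingHom_coe
    (HeightOneSpectrum.uniformContinuous_algebraMap_liesOver F K v w).continuous
    ((WithVal.equiv (v.valuation F)).symm x)

scoped instance adicTower : IsScalarTower F (v.adicCompletion F) (w.adicCompletion K) :=
  .of_algebraMap_eq fun x ↦ (adicMap_algebraMap v w x).symm

scoped instance adicContinuousSMul :
    ContinuousSMul (v.adicCompletion F) (w.adicCompletion K) where
  continuous_smul := ((continuous_adicMap v w).comp continuous_fst).mul continuous_snd

open scoped Valued

theorem exists_norm_adicMap : ∃ s : ℝ, 0 < s ∧ ∀ x : v.adicCompletion F,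
    ‖algebraMap (v.adicCompletion F) (w.adicCompletion K) x‖ = ‖x‖ ^ s := by
  have hv := HeightOneSpectrum.one_lt_absNorm v
  have hw := HeightOneSpectrum.one_lt_absNorm w
  set a : ℝ := (Ideal.absNorm v.asIdeal : ℝ)
  set b : ℝ := (Ideal.absNorm w.asIdeal : ℝ)
  have ha : 1 < a := Nat.one_lt_cast.2 hv
  have hb : 1 < b := Nat.one_lt_cast.2 hw
  set e := v.asIdeal.ramificationIdx' w.asIdeal
  have he : 0 < e := Nat.pos_of_ne_zero
    (Ideal.IsDedekindDomain.ramificationIdx'_ne_zero_of_liesOver w.asIdeal v.ne_bot)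
  have hs : 0 < e * (Real.log b / Real.log a) :=
    mul_pos (by exact_mod_cast he) (div_pos (Real.log_pos hb) (Real.log_pos ha))
  refine ⟨e * (Real.log b / Real.log a), hs, fun x => ?_⟩
  have hc : Continuous fun x : v.adicCompletion F =>
      ‖algebraMap (v.adicCompletion F) (w.adicCompletion K) x‖ :=
    (continuous_adicMap v w).norm
  have hc' : Continuous fun x : v.adicCompletion F =>
      ‖x‖ ^ (e * (Real.log b / Real.log a)) :=
    continuous_norm.rpow_const fun _ => Or.inr hs.le
  refine congrFun ((HeightOneSpectrum.denseRange_algebraMap F v).equalizer hc hc' ?_) x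
  funext y
  have h1 : algebraMap (v.adicCompletion F) (w.adicCompletion K)
      (algebraMap F (v.adicCompletion F) y) =
      FinitePlace.embedding w (algebraMap F K y) := adicMap_algebraMap v w y
  have h2 : algebraMap F (v.adicCompletion F) y = FinitePlace.embedding v y := rfl
  simp only [Function.comp_apply, h1]
  rw [h2, FinitePlace.norm_embedding', FinitePlace.norm_embedding',
    ← HeightOneSpectrum.valuation_liesOver K v w]
  rcases eq_or_ne y 0 with rfl | hy
  · simp only [map_zero, NNReal.coe_zero]
    rw [Real.zero_rpow hs.ne', zero_pow he.ne', map_zero, NNReal.coe_zero]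
  · have hm : v.valuation F y ≠ 0 := (Valuation.ne_zero_iff _).2 hy
    rw [map_pow, WithZeroMulInt.toNNReal_neg_apply _ hm, WithZeroMulInt.toNNReal_neg_apply _ hm]
    generalize Multiplicative.toAdd (WithZero.unzero hm) = k
    push_cast
    change (b ^ k) ^ e = (a ^ k) ^ ((e : ℝ) * (Real.log b / Real.log a))
    have ha0 : 0 < a := by linarith
    have hb0 : 0 < b := by linarith
    rw [mul_comm, Real.rpow_mul (by positivity), Real.rpow_natCast, ← Real.rpow_intCast a,
      ← Real.rpow_mul ha0.le, mul_comm, Real.rpow_mul ha0.le, Real.rpow_def_of_pos ha0,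
      mul_div_cancel₀ _ (Real.log_pos ha).ne', Real.exp_log hb0, Real.rpow_intCast]

theorem adic_isIntegral_iff (x : w.adicCompletion K) :
    IsIntegral (v.adicCompletionIntegers F) x ↔ x ∈ w.adicCompletionIntegers K := by
  obtain ⟨s, hs, h⟩ := exists_norm_adicMap v w
  let f : AbsoluteValue (w.adicCompletion K) ℝ :=
    { toFun := fun x => ‖x‖ ^ s⁻¹
      map_mul' := fun x y => by
        rw [norm_mul, Real.mul_rpow (norm_nonneg _) (norm_nonneg _)]
      nonneg' := fun x => by positivity
      eq_zero' := fun x => by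
        rw [Real.rpow_eq_zero (norm_nonneg _) (inv_pos.2 hs).ne', norm_eq_zero]
      add_le' := fun x y => by
        have h1 : ‖x + y‖ ≤ max ‖x‖ ‖y‖ := IsUltrametricDist.norm_add_le_max x y
        have h2 := Real.rpow_le_rpow (norm_nonneg _) h1 (inv_pos.2 hs).le
        refine h2.trans ?_
        have hx : 0 ≤ ‖x‖ ^ s⁻¹ := by positivity
        have hy : 0 ≤ ‖y‖ ^ s⁻¹ := by positivity
        rcases max_choice ‖x‖ ‖y‖ with h | h <;> rw [h] <;> linarith }
  have hf (a : v.adicCompletion F) : f (algebraMap _ (w.adicCompletion K) a) = ‖a‖ := by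
    change ‖algebraMap _ (w.adicCompletion K) a‖ ^ s⁻¹ = _
    rw [h, Real.rpow_rpow_inv (norm_nonneg _) hs.ne']
  have h1 : f x = spectralNorm _ _ x := spectralNorm_unique_field_norm_ext hf x
  rw [adic_isIntegral_iff_spectralNorm v, ← h1]
  change ‖x‖ ^ s⁻¹ ≤ 1 ↔ _
  rw [← Real.one_rpow s⁻¹,
    Real.rpow_le_rpow_iff (norm_nonneg _) zero_le_one (inv_pos.2 hs), Valued.toNormedField.norm_le_one_iff]
  rfl

end Completions
section Functoriality
variable {k k' k'' E L M : Type*} [Field k] [Field k'] [Field k''] [Field E] [Field L] [Field M]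
  [Algebra k E] [Algebra k k'] [Algebra k' L] [Algebra k L] [IsScalarTower k k' L]

theorem H1.mk_surjective {U : Subgroup Eˣ} (x : H1 k U) : ∃ c, x = H1.mk c := by
  obtain ⟨c, hc⟩ := QuotientGroup.mk_surjective
    (s := (coboundaries k U).subgroupOf (cocycles k U)) (Additive.toMul x)
  exact ⟨c, congrArg Additive.ofMul hc.symm⟩

theorem H1.mk_eq {U : Subgroup Eˣ} {c d : cocycles k U} {u : Eˣ} (hu : u ∈ U)
    (h : ∀ σ : Gal(E/k), d.1 σ = c.1 σ * (σ • u / u)) : H1.mk c = H1.mk d := by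
  refine congrArg Additive.ofMul (QuotientGroup.eq.2 ?_)
  exact ⟨u, hu, fun σ => by simp [h]⟩

theorem H1.map_congr [Normal k E] (f g : E →ₐ[k] L) (U : Subgroup Eˣ) (V : Subgroup Lˣ)
    (hf : U ≤ V.comap (Units.map (f : E →* L))) (hg : U ≤ V.comap (Units.map (g : E →* L)))
    (x : H1 k U) : (H1.map f U V hf x : H1 k' V) = H1.map g U V hg x := by
  obtain ⟨c, rfl⟩ := H1.mk_surjective x
  obtain ⟨s, hs⟩ : ∃ s : Gal(E/k), ∀ x, g (s x) = f x := by
    let _ : Algebra E L := g.toRingHom.toAlgebra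
    have : IsScalarTower k E L := .of_algebraMap_eq fun x => (g.commutes x).symm
    exact ⟨f.restrictNormal' E, AlgHom.restrictNormal_commutes f E⟩
  rw [H1.map_mk, H1.map_mk]
  refine (H1.mk_eq (u := Units.map (g : E →* L) (c.1 s)) (hg (c.2.1 s)) fun τ => ?_).symm
  change Units.map (f : E →* L) (c.1 (galRestrict f τ)) =
    Units.map (g : E →* L) (c.1 (galRestrict g τ)) * _
  have h1 : galRestrict g τ * s = s * galRestrict f τ := by
    ext x
    apply g.injective
    change g (galRestrict g τ (s x)) = g (s (galRestrict f τ x))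
    rw [galRestrict_spec, hs, hs, galRestrict_spec]
  have h2 := congrArg c.1 h1
  rw [c.2.2.2, c.2.2.2] at h2
  have h3 (u : Eˣ) : Units.map (f : E →* L) u = Units.map (g : E →* L) (s • u) :=
    Units.ext (hs u).symm
  rw [h3, ← galRestrict_smul, ← map_div, ← map_mul]
  congr 1
  rw [mul_div_assoc', eq_div_iff_mul_eq', ← h2, mul_comm]

theorem H1.map_map [Normal k E] [Normal k' L] [Algebra k' k''] [Algebra k'' M] [Algebra k' M]
    [IsScalarTower k' k'' M] [Algebra k k''] [Algebra k M] [IsScalarTower k k' M]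
    [IsScalarTower k k'' M] (f : E →ₐ[k] L) (g : L →ₐ[k'] M)
    (U : Subgroup Eˣ) (V : Subgroup Lˣ) (W : Subgroup Mˣ)
    (hf : U ≤ V.comap (Units.map (f : E →* L))) (hg : V ≤ W.comap (Units.map (g : L →* M)))
    (h : U ≤ W.comap (Units.map (((g.restrictScalars k).comp f : E →ₐ[k] M) : E →* M)))
    (x : H1 k U) : (H1.map g V W hg (H1.map f U V hf x : H1 k' V) : H1 k'' W) =
      H1.map ((g.restrictScalars k).comp f) U W h x := by
  obtain ⟨c, rfl⟩ := H1.mk_surjective x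
  rw [H1.map_mk, H1.map_mk, H1.map_mk]
  refine congrArg H1.mk (Subtype.ext (funext fun τ => ?_))
  change Units.map (g : L →* M) (Units.map (f : E →* L) (c.1 (galRestrict f (galRestrict g τ)))) =
    Units.map (((g.restrictScalars k).comp f : E →ₐ[k] M) : E →* M)
      (c.1 (galRestrict ((g.restrictScalars k).comp f) τ))
  have h1 : galRestrict f (galRestrict g τ) = galRestrict ((g.restrictScalars k).comp f) τ := by
    ext x
    apply ((g.restrictScalars k).comp f).injective
    refine Eq.trans ?_ (galRestrict_spec ((g.restrictScalars k).comp f) τ x).symm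
    change g (f (galRestrict f (galRestrict g τ) x)) = τ (g (f x))
    rw [galRestrict_spec, galRestrict_spec]
  rw [h1]
  rfl

/-- The group of units of the integral closure of `O` in the field `E`. For `O = ℤ` and a number
field `E` this is the unit group of its ring of integers. -/
def integralUnits (O : Type*) (E : Type*) [CommRing O] [Field E] [Algebra O E] : Subgroup Eˣ :=
  (integralClosure O E).toSubmonoid.units

theorem mem_integralUnits {O E : Type*} [CommRing O] [Field E] [Algebra O E] {u : Eˣ} :
    u ∈ integralUnits O E ↔ IsIntegral O (u : E) ∧ IsIntegral O ((u⁻¹ : Eˣ) : E) :=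
  Submonoid.mem_units_iff _ _

end Functoriality

section Support

theorem integralUnits_le_comap {O O' E L : Type*} [CommRing O] [CommRing O'] [Field E] [Field L]
    [Algebra O E] [Algebra O' L] (φ : O →+* O') (f : E →+* L)
    (h : ∀ a, f (algebraMap O E a) = algebraMap O' L (φ a)) :
    integralUnits O E ≤ (integralUnits O' L).comap (Units.map (f : E →* L)) := by
  intro u hu
  rw [mem_integralUnits] at hu
  rw [Subgroup.mem_comap, mem_integralUnits, ← map_inv]
  have hc : (algebraMap O' L).comp φ = f.comp (algebraMap O E) := RingHom.ext fun a => (h a).symm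
  exact ⟨hu.1.map_of_comp_eq φ f hc, hu.2.map_of_comp_eq φ f hc⟩

/-- `integralUnits O E` is stable under the automorphisms of `E` over a field containing `O`. -/
theorem smul_mem_integralUnits {O k E : Type*} [CommRing O] [Field k] [Field E] [Algebra O k]
    [Algebra k E] [Algebra O E] [IsScalarTower O k E] (σ : Gal(E/k)) {u : Eˣ}
    (hu : u ∈ integralUnits O E) : σ • u ∈ integralUnits O E :=
  integralUnits_le_comap (RingHom.id O) (σ : E →+* E) (fun a =>
    (congrArg σ (IsScalarTower.algebraMap_apply O k E a)).trans <|
      (σ.commutes _).trans (IsScalarTower.algebraMap_apply O k E a).symm) hu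

theorem finite_setOf_map_ne_zero {F E : Type*} [Field F] [NumberField F] [Field E] [Algebra F E]
    [IsGalois F E] (x : H1 F (integralUnits ℤ E)) : ∃ S : Set (HeightOneSpectrum (𝓞 F)),
      S.Finite ∧ ∀ v ∉ S, ∀ (L : Type*) [Field L] [Algebra (v.adicCompletion F) L]
      [Algebra F L] [IsScalarTower F (v.adicCompletion F) L]
      [Algebra (v.adicCompletionIntegers F) L]
      [IsScalarTower (v.adicCompletionIntegers F) (v.adicCompletion F) L]
      (f : E →ₐ[F] L) (V : Subgroup Lˣ) (_ : integralUnits (v.adicCompletionIntegers F) L ≤ V)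
      (h : integralUnits ℤ E ≤ V.comap (Units.map (f : E →* L))),
      (H1.map f (integralUnits ℤ E) V h x : H1 (v.adicCompletion F) V) = 0 := by
  obtain ⟨c, rfl⟩ := H1.mk_surjective x
  obtain ⟨y, hy⟩ := exists_eq_smul_div c.1 c.2.2.1 c.2.2.2
  have key (z : E) : ∃ a : F, a ≠ 0 ∧ IsIntegral (𝓞 F) (algebraMap F E a * z) := by
    have hz : IsAlgebraic (𝓞 F) z :=
      (IsFractionRing.isAlgebraic_iff (𝓞 F) F E).2 (Algebra.IsAlgebraic.isAlgebraic z)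
    obtain ⟨a, ha, h⟩ := hz.exists_integral_multiple
    refine ⟨algebraMap (𝓞 F) F a, ?_, ?_⟩
    · simpa using ha
    · rwa [← IsScalarTower.algebraMap_apply, ← Algebra.smul_def]
  have key2 (z : E) : ∃ S : Set (HeightOneSpectrum (𝓞 F)),
      S.Finite ∧ ∀ v ∉ S, ∀ (L : Type _) [Field L] [Algebra (v.adicCompletion F) L]
      [Algebra F L] [IsScalarTower F (v.adicCompletion F) L]
      [Algebra (v.adicCompletionIntegers F) L]
      [IsScalarTower (v.adicCompletionIntegers F) (v.adicCompletion F) L]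
      (f : E →ₐ[F] L), IsIntegral (v.adicCompletionIntegers F) (f z) := by
    obtain ⟨a, ha, hz⟩ := key z
    refine ⟨_, HeightOneSpectrum.Support.finite (𝓞 F) a⁻¹, fun v hv L _ _ _ _ _ _ f => ?_⟩
    have hv' : v.valuation F a⁻¹ ≤ 1 := not_lt.1 hv
    let b : v.adicCompletionIntegers F := ⟨algebraMap F (v.adicCompletion F) a⁻¹, by
      rw [HeightOneSpectrum.mem_adicCompletionIntegers]
      exact (HeightOneSpectrum.valuedAdicCompletion_eq_valuation' v a⁻¹).trans_le hv'⟩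
    have h1 : IsIntegral (v.adicCompletionIntegers F) (f (algebraMap F E a * z)) :=
      hz.map_of_comp_eq (algebraMap (𝓞 F) (v.adicCompletionIntegers F)) (f : E →+* L) <| by
        ext r
        simp only [RingHom.comp_apply, RingHom.coe_coe]
        rw [IsScalarTower.algebraMap_apply (𝓞 F) F E, f.commutes,
          IsScalarTower.algebraMap_apply F (v.adicCompletion F) L,
          IsScalarTower.algebraMap_apply (v.adicCompletionIntegers F) (v.adicCompletion F) L]
        rfl
    have h2 : f z = algebraMap (v.adicCompletionIntegers F) L b * f (algebraMap F E a * z) := by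
      rw [IsScalarTower.algebraMap_apply (v.adicCompletionIntegers F) (v.adicCompletion F) L]
      change _ = algebraMap (v.adicCompletion F) L (algebraMap F (v.adicCompletion F) a⁻¹) * _
      rw [← IsScalarTower.algebraMap_apply, map_mul, f.commutes, ← mul_assoc, ← map_mul,
        inv_mul_cancel₀ ha, map_one, one_mul]
    rw [h2]
    exact isIntegral_algebraMap.mul h1
  obtain ⟨S, hS, hS'⟩ := key2 y
  obtain ⟨T, hT, hT'⟩ := key2 (y⁻¹ : Eˣ)
  refine ⟨S ∪ T, hS.union hT, fun v hv L _ _ _ _ _ _ f V hV h => ?_⟩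
  rw [Set.mem_union, not_or] at hv
  rw [H1.map_mk]
  refine (H1.mk_eq (c := 1) (u := Units.map (f : E →* L) y) (hV ?_) fun τ => ?_).symm
  · rw [mem_integralUnits, ← map_inv]
    exact ⟨hS' v hv.1 L f, hT' v hv.2 L f⟩
  · change Units.map (f : E →* L) (c.1 (galRestrict f τ)) = 1 * _
    rw [hy, map_div, galRestrict_smul, one_mul]

end Support

section Diagram

open scoped NumberField.LiesOver

section Local

variable {F K : Type*} [Field F] [NumberField F] [Field K] [NumberField K] [Algebra F K]

instance adicNormal [IsGalois F K] (v : HeightOneSpectrum (𝓞 F)) (w : HeightOneSpectrum (𝓞 K))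
    [w.asIdeal.LiesOver v.asIdeal] : Normal (v.adicCompletion F) (w.adicCompletion K) :=
  open scoped Valued in
  normal_of_denseRange (F := F) (K := K) (HeightOneSpectrum.denseRange_algebraMap K w)

instance infTower (w : InfinitePlace K) : IsScalarTower F K w.Completion :=
  .of_algebraMap_eq fun _ => rfl

instance infNormal [IsGalois F K] (v : InfinitePlace F) (w : InfinitePlace K) [w.LiesOver v] :
    Normal v.Completion w.Completion := by
  have h2 : ‖(2 : v.Completion)‖ = 2 := by
    have h := (AddMonoidHomClass.isometry_iff_norm _).1
      (InfinitePlace.Completion.isometry_extensionEmbedding v) 2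
    rw [map_ofNat] at h
    simpa using h.symm
  let _ : NontriviallyNormedField v.Completion := NontriviallyNormedField.ofNormNeOne
    ⟨2, fun h => by simp [h] at h2, by simp [h2]⟩
  have hd : DenseRange (algebraMap K w.Completion) :=
    (InfinitePlace.Completion.denseRange_coe w).comp
      (WithAbs.equiv w.1).symm.surjective.denseRange (InfinitePlace.Completion.continuous_coe w)
  exact normal_of_denseRange (F := F) (K := K) hd

theorem unitGroup_eq_integralUnits (v : HeightOneSpectrum (𝓞 F)) (w : HeightOneSpectrum (𝓞 K))
    [w.asIdeal.LiesOver v.asIdeal] : (w.adicCompletionIntegers K).unitGroup =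
      integralUnits (v.adicCompletionIntegers F) (w.adicCompletion K) := by
  ext u
  rw [mem_integralUnits, adic_isIntegral_iff, adic_isIntegral_iff,
    ← ValuationSubring.valuation_le_one_iff, ← ValuationSubring.valuation_le_one_iff,
    ValuationSubring.mem_unitGroup_iff]
  have h : (w.adicCompletionIntegers K).valuation (u : w.adicCompletion K) ≠ 0 := by simp
  rw [Units.val_inv_eq_inv_val, map_inv₀, inv_le_one₀ (zero_lt_iff.2 h)]
  exact le_antisymm_iff

end Local

variable (F K : Type*) [Field F] [NumberField F] [Field K] [NumberField K] [Algebra F K]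

/-- The places of a number field: the finite ones and the infinite ones. -/
abbrev Place (F : Type*) [Field F] [NumberField F] : Type _ :=
  HeightOneSpectrum (𝓞 F) ⊕ InfinitePlace F

/-- The choices entering the localization and inflation maps of an extension `K/F` of number
fields: an embedding of `K` into the algebraic closure `F^al` over `F` and, for each place `v` of `F`,
a place `w` of `K` above `v`, an embedding of `K_w` into the algebraic closure of `F_v` over `F_v`,
and an embedding of `F^al` into the algebraic closure of `F_v` over `F`. The embeddings need not be
compatible with each other. -/
structure Choices where
  emb : K →ₐ[F] AlgebraicClosure F
  finPlace : HeightOneSpectrum (𝓞 F) → HeightOneSpectrum (𝓞 K)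
  finPlace_liesOver : ∀ v, (finPlace v).asIdeal.LiesOver v.asIdeal
  infPlace : InfinitePlace F → InfinitePlace K
  infPlace_liesOver : ∀ v, (infPlace v).LiesOver v
  finEmb : ∀ v, (finPlace v).adicCompletion K →ₐ[v.adicCompletion F]
    AlgebraicClosure (v.adicCompletion F)
  infEmb : ∀ v, (infPlace v).Completion →ₐ[v.Completion] AlgebraicClosure v.Completion
  finEmbBar : ∀ v : HeightOneSpectrum (𝓞 F),
    AlgebraicClosure F →ₐ[F] AlgebraicClosure (v.adicCompletion F)
  infEmbBar : ∀ v : InfinitePlace F, AlgebraicClosure F →ₐ[F] AlgebraicClosure v.Completion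

attribute [instance] Choices.finPlace_liesOver Choices.infPlace_liesOver

variable {F K}

/-- `H¹(G_w, U_{K_w})` for the chosen place `w` of `K` above `v`, where `G_w = Gal(K_w/F_v)` and
`U_{K_w}` is the group of units of the valuation ring of `K_w` if `v` is finite, and `K_wˣ` if
`v` is infinite. -/
def LocalH1 (D : Choices F K) : Place F → Type _
  | .inl v => H1 (v.adicCompletion F) ((D.finPlace v).adicCompletionIntegers K).unitGroup
  | .inr v => H1 v.Completion (⊤ : Subgroup ((D.infPlace v).Completion)ˣ)

noncomputable instance (D : Choices F K) : ∀ v, AddCommGroup (LocalH1 D v)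
  | .inl v => inferInstanceAs <| AddCommGroup <|
      H1 (v.adicCompletion F) ((D.finPlace v).adicCompletionIntegers K).unitGroup
  | .inr v => inferInstanceAs <| AddCommGroup <|
      H1 v.Completion (⊤ : Subgroup ((D.infPlace v).Completion)ˣ)

variable (F) in
/-- `H¹(G_{F_v}, U_{F_v^al})`, where `G_{F_v}` is the absolute Galois group of `F_v` and `U_{F_v^al}` is
the group of units of the valuation ring of `F_v^al` (the integral closure of that of `F_v`) if `v` is
finite, and `(F_v^al)ˣ` if `v` is infinite. -/
def LocalH1Bar : Place F → Type _
  | .inl v => H1 (v.adicCompletion F)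
      (integralUnits (v.adicCompletionIntegers F) (AlgebraicClosure (v.adicCompletion F)))
  | .inr v => H1 v.Completion (⊤ : Subgroup (AlgebraicClosure v.Completion)ˣ)

noncomputable instance : ∀ v, AddCommGroup (LocalH1Bar F v)
  | .inl v => inferInstanceAs <| AddCommGroup <| H1 (v.adicCompletion F)
      (integralUnits (v.adicCompletionIntegers F) (AlgebraicClosure (v.adicCompletion F)))
  | .inr v => inferInstanceAs <| AddCommGroup <|
      H1 v.Completion (⊤ : Subgroup (AlgebraicClosure v.Completion)ˣ)

theorem globalUnits_le_comap {F E L : Type*} [Field F] [Field E] [Algebra F E] [Field L]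
    (O : Type*) [CommRing O] [Algebra O L] [Algebra F L] (f : E →ₐ[F] L) :
    integralUnits ℤ E ≤ (integralUnits O L).comap (Units.map (f : E →* L)) :=
  integralUnits_le_comap (Int.castRingHom O) (f : E →+* L) fun a => by simp

theorem globalUnits_le_unitGroup (v : HeightOneSpectrum (𝓞 F)) (w : HeightOneSpectrum (𝓞 K))
    [w.asIdeal.LiesOver v.asIdeal] (f : K →ₐ[F] w.adicCompletion K) :
    integralUnits ℤ K ≤ ((w.adicCompletionIntegers K).unitGroup).comap
      (Units.map (f : K →* w.adicCompletion K)) := by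
  rw [unitGroup_eq_integralUnits v]
  exact globalUnits_le_comap _ _

theorem unitGroup_le_comap (v : HeightOneSpectrum (𝓞 F)) (w : HeightOneSpectrum (𝓞 K))
    [w.asIdeal.LiesOver v.asIdeal]
    (f : w.adicCompletion K →ₐ[v.adicCompletion F] AlgebraicClosure (v.adicCompletion F)) :
    (w.adicCompletionIntegers K).unitGroup ≤
      (integralUnits (v.adicCompletionIntegers F) (AlgebraicClosure (v.adicCompletion F))).comap
        (Units.map (f : w.adicCompletion K →* AlgebraicClosure (v.adicCompletion F))) := by
  rw [unitGroup_eq_integralUnits v]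
  exact integralUnits_le_comap (RingHom.id _)
    (f : w.adicCompletion K →+* AlgebraicClosure (v.adicCompletion F)) fun a => f.commutes a

open scoped DirectSum

/-- A family of homomorphisms that is pointwise finitely supported, as a homomorphism to the
direct sum. -/
noncomputable def toDirectSum {ι A : Type*} {B : ι → Type*} [AddCommGroup A] [∀ i, AddCommGroup (B i)]
    (φ : ∀ i, A →+ B i) (h : ∀ a, {i | φ i a ≠ 0}.Finite) : A →+ ⨁ i, B i where
  toFun a := ⟨fun i => φ i a, Trunc.mk ⟨(h a).toFinset.val, fun i => by
    by_cases hi : φ i a = 0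
    · exact Or.inr hi
    · exact Or.inl ((h a).mem_toFinset.2 hi)⟩⟩
  map_zero' := DFinsupp.ext fun i => map_zero (φ i)
  map_add' a b := DFinsupp.ext fun i => map_add (φ i) a b

variable (D : Choices F K)

/-- The localization map `H¹(G_F, U_{F^al}) → H¹(G_{F_v}, U_{F_v^al})` at `v`. -/
noncomputable def locBar : ∀ v, H1 F (integralUnits ℤ (AlgebraicClosure F)) →+ LocalH1Bar F v
  | .inl v => (H1.map (D.finEmbBar v) _ _ (globalUnits_le_comap _ _) :
      _ →+ H1 (v.adicCompletion F) _)
  | .inr v => (H1.map (D.infEmbBar v) _ ⊤ le_top : _ →+ H1 v.Completion _)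

theorem locBar_finite (x : H1 F (integralUnits ℤ (AlgebraicClosure F))) :
    {v | locBar D v x ≠ 0}.Finite := by
  obtain ⟨S, hS, h⟩ := finite_setOf_map_ne_zero x
  refine ((hS.image Sum.inl).union (Set.finite_range Sum.inr)).subset fun v hv => ?_
  rcases v with v | v
  · refine Or.inl ⟨v, by_contra fun hvS => hv ?_, rfl⟩
    exact h v hvS _ (D.finEmbBar v) _ le_rfl (globalUnits_le_comap _ _)
  · exact Or.inr ⟨v, rfl⟩

/-- The localization map `H¹(G_F, U_{F^al}) → ⨁_v H¹(G_{F_v}, U_{F_v^al})`. -/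
noncomputable def mapG : H1 F (integralUnits ℤ (AlgebraicClosure F)) →+ ⨁ v, LocalH1Bar F v :=
  toDirectSum (locBar D) (locBar_finite D)

variable [IsGalois F K]

/-- The localization map `H¹(G, U_K) → H¹(G_w, U_{K_w})` at `v`. -/
noncomputable def loc : ∀ v, H1 F (integralUnits ℤ K) →+ LocalH1 D v
  | .inl v => (H1.map (IsScalarTower.toAlgHom F K ((D.finPlace v).adicCompletion K)) _ _
      (globalUnits_le_unitGroup v (D.finPlace v) _) : _ →+ H1 (v.adicCompletion F) _)
  | .inr v => (H1.map (IsScalarTower.toAlgHom F K (D.infPlace v).Completion) _ ⊤ le_top :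
      _ →+ H1 v.Completion _)

/-- The inflation map `H¹(G_w, U_{K_w}) → H¹(G_{F_v}, U_{F_v^al})` at `v`. -/
noncomputable def locInf : ∀ v, LocalH1 D v →+ LocalH1Bar F v
  | .inl v => (H1.map (D.finEmb v) _ _ (unitGroup_le_comap v (D.finPlace v) _) :
      H1 (v.adicCompletion F) _ →+ H1 (v.adicCompletion F) _)
  | .inr v => (H1.map (D.infEmb v) ⊤ ⊤ le_top : H1 v.Completion _ →+ H1 v.Completion _)

/-- The inflation map `H¹(G, U_K) → H¹(G_F, U_{F^al})`. -/
noncomputable def inflation : H1 F (integralUnits ℤ K) →+ H1 F (integralUnits ℤ (AlgebraicClosure F)) :=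
  H1.map D.emb _ _ (globalUnits_le_comap _ _)

theorem locInf_loc (v : Place F) (x : H1 F (integralUnits ℤ K)) :
    locInf D v (loc D v x) = locBar D v (inflation D x) := by
  rcases v with v | v
  · refine (H1.map_map (IsScalarTower.toAlgHom F K ((D.finPlace v).adicCompletion K)) (D.finEmb v)
      _ _ _ (globalUnits_le_unitGroup v (D.finPlace v) _)
      (unitGroup_le_comap v (D.finPlace v) _) (globalUnits_le_comap _ _) x).trans ?_
    refine Eq.trans ?_ (H1.map_map D.emb (D.finEmbBar v) _ _ _ (globalUnits_le_comap _ _)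
      (globalUnits_le_comap _ _) (globalUnits_le_comap _ _) x).symm
    exact H1.map_congr _ _ _ _ _ _ x
  · refine (H1.map_map (IsScalarTower.toAlgHom F K (D.infPlace v).Completion) (D.infEmb v)
      _ ⊤ ⊤ le_top le_top le_top x).trans ?_
    refine Eq.trans ?_ (H1.map_map D.emb (D.infEmbBar v) _ _ ⊤ (globalUnits_le_comap _ _)
      le_top le_top x).symm
    exact H1.map_congr _ _ _ _ _ _ x

theorem loc_finite (x : H1 F (integralUnits ℤ K)) : {v | loc D v x ≠ 0}.Finite := by
  obtain ⟨S, hS, h⟩ := finite_setOf_map_ne_zero x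
  refine ((hS.image Sum.inl).union (Set.finite_range Sum.inr)).subset fun v hv => ?_
  rcases v with v | v
  · refine Or.inl ⟨v, by_contra fun hvS => hv ?_, rfl⟩
    exact h v hvS _ (IsScalarTower.toAlgHom F K ((D.finPlace v).adicCompletion K)) _
      (unitGroup_eq_integralUnits v (D.finPlace v)).ge
      (globalUnits_le_unitGroup v (D.finPlace v) _)
  · exact Or.inr ⟨v, rfl⟩

/-- The localization map `H¹(G, U_K) → ⨁_v H¹(G_w, U_{K_w})`. -/
noncomputable def mapF : H1 F (integralUnits ℤ K) →+ ⨁ v, LocalH1 D v :=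
  toDirectSum (loc D) (loc_finite D)

/-- The sum of the local inflation maps. -/
noncomputable def sumInf : (⨁ v, LocalH1 D v) →+ ⨁ v, LocalH1Bar F v :=
  DirectSum.map (locInf D)

theorem sumInf_mapF (x : H1 F (integralUnits ℤ K)) : sumInf D (mapF D x) = mapG D (inflation D x) :=
  DFinsupp.ext fun v => (DirectSum.map_apply _ _ _).trans (locInf_loc D v x)

/-- The map from the cokernel of `mapF` to the cokernel of `mapG` induced by the commutative square
`sumInf ∘ mapF = mapG ∘ inflation`. -/
noncomputable def mapI :
    ((⨁ v, LocalH1 D v) ⧸ (mapF D).range) →+ (⨁ v, LocalH1Bar F v) ⧸ (mapG D).range :=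
  QuotientAddGroup.map _ _ (sumInf D) <| by
    rintro _ ⟨x, rfl⟩
    exact ⟨inflation D x, (sumInf_mapF D x).symm⟩

end Diagram

end UnitCohomology

namespace UnitCohomology

/-! ### Hilbert 90 and cocycles of the form `σ(y)/y` -/

section General

variable {k E : Type*} [Field k] [Field E] [Algebra k E]

/-! The target of `mapI` is already zero: the localization map `mapG` over the algebraic closure is
surjective (`mapG_surjective`), so its cokernel vanishes.

By Hilbert 90, a class with values in a group of units `U` is given by a cocycle `σ(y)/y`, where `y`
is any nonzero element of the field whose quotients `σ(y)/y` lie in `U`; the class depends only on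
`y` modulo `U`. At an infinite place `U` is the whole multiplicative group, so the local group is
zero. At a finite place `v`, only the valuation of `y` matters. Comparing `y` with its conjugates
shows that some power `y^n` equals an element `b` of `F_v` up to a unit
(`exists_pow_div_algebraMap_mem`), so this valuation is rational.

It remains to realize a rational valuation at `v` by a global element that is a unit at all other
finite places (`exists_locBar_eq`). Finiteness of the class number gives `a` in `F` generating a
power `v^h` (`exists_valuation_eq`). A suitable root `z` of a power of `a` then has the same
valuation as `y` at `v` and is a unit elsewhere. Since a power of `z` lies in `F`, each `σ(z)/z` is
a root of unity, so `z` defines a class with values in the global units. This class localizes to the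
given one at `v` and to zero at every other place. Such one-place classes generate the direct sum.
-/

theorem isLocallyConstant_smul [Algebra.IsAlgebraic k E] (u : Eˣ) :
    IsLocallyConstant fun σ : Gal(E/k) => σ • u := by
  rw [IsLocallyConstant.iff_exists_open]
  intro σ
  let M := IntermediateField.adjoin k {(u : E)}
  have : FiniteDimensional k M :=
    IntermediateField.adjoin.finiteDimensional (Algebra.IsIntegral.isIntegral _)
  -- The function is constant on left cosets of the subgroup fixing `k(u)`, which is open because
  -- `k(u)/k` is finite.
  refine ⟨_, M.fixingSubgroup_isOpen.leftCoset σ, ⟨1, one_mem _, mul_one σ⟩, ?_⟩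
  rintro _ ⟨τ, hτ, rfl⟩
  ext
  have h := (IntermediateField.mem_fixingSubgroup_iff _ _).1 hτ u
    (IntermediateField.mem_adjoin_simple_self k (u : E))
  exact congrArg σ h

/-- The cocycle `σ ↦ σ(y)/y` with values in `U`. -/
def divCocycle [Algebra.IsAlgebraic k E] (U : Subgroup Eˣ) (y : Eˣ)
    (h : ∀ σ : Gal(E/k), σ • y / y ∈ U) : cocycles k U :=
  ⟨fun σ => σ • y / y, h, (isLocallyConstant_smul y).comp (· / y), fun σ τ => by
    simp only [smul_div', mul_smul, div_mul_div_cancel]⟩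

/-- Hilbert 90: a cocycle with values in `U` becomes a coboundary in all of `Eˣ`. The element `y`
need not lie in `U`, and that is the only obstruction to the class being zero. -/
theorem exists_eq_mk_divCocycle [IsGalois k E] {U : Subgroup Eˣ} (x : H1 k U) :
    ∃ (y : Eˣ) (h : ∀ σ : Gal(E/k), σ • y / y ∈ U), x = H1.mk (divCocycle U y h) := by
  obtain ⟨c, rfl⟩ := H1.mk_surjective x
  obtain ⟨y, hy⟩ := exists_eq_smul_div c.1 c.2.2.1 c.2.2.2
  exact ⟨y, fun σ => hy σ ▸ c.2.1 σ, congrArg H1.mk (Subtype.ext (funext hy))⟩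

theorem mk_divCocycle_eq_zero [Algebra.IsAlgebraic k E] {U : Subgroup Eˣ} {y : Eˣ}
    (h : ∀ σ : Gal(E/k), σ • y / y ∈ U) (hy : y ∈ U) : H1.mk (divCocycle U y h) = 0 :=
  (H1.mk_eq (c := 1) hy fun _ => (one_mul _).symm).symm

/-- The two cocycles differ by the coboundary of `f(z)/y`. Comparing a localized class with a local
one therefore reduces to showing that one quotient lies in `V`. -/
theorem map_mk_divCocycle {k' L : Type*} [Field k'] [Field L] [Algebra k k'] [Algebra k' L]
    [Algebra k L] [IsScalarTower k k' L] [Normal k E] [Algebra.IsAlgebraic k' L]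
    (f : E →ₐ[k] L) {U : Subgroup Eˣ} {V : Subgroup Lˣ}
    (hUV : U ≤ V.comap (Units.map (f : E →* L))) {z : Eˣ} {y : Lˣ}
    (hz : ∀ σ : Gal(E/k), σ • z / z ∈ U) (hy : ∀ σ : Gal(L/k'), σ • y / y ∈ V)
    (h : Units.map (f : E →* L) z / y ∈ V) :
    H1.map f U V hUV (H1.mk (divCocycle U z hz)) = H1.mk (divCocycle V y hy) := by
  rw [H1.map_mk]
  refine (H1.mk_eq h fun σ => ?_).symm
  change Units.map (f : E →* L) (galRestrict f σ • z / z) = _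
  change _ = σ • y / y * _
  rw [map_div, galRestrict_smul, smul_div', div_mul_div_comm, mul_comm, mul_comm y,
    div_mul_cancel, div_mul_cancel]

/-- If all `σ(y)/y` lie in `U`, then a power of `y` is in `U` up to an element of the base field. -/
theorem exists_pow_div_algebraMap_mem [Normal k E] {U : Subgroup Eˣ} {y : Eˣ}
    (h : ∀ σ : Gal(E/k), σ • y / y ∈ U) :
    ∃ n : ℕ, 0 < n ∧ ∃ b : kˣ, y ^ n / Units.map (algebraMap k E : k →* E) b ∈ U := by
  have hi : IsIntegral k (y : E) := Algebra.IsIntegral.isIntegral _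
  -- Each conjugate of `y` agrees with `y` modulo `U`, so a product of conjugates agrees with the
  -- corresponding power of `y`. This is applied to all roots of the minimal polynomial.
  have key (s : Multiset E) (hs : ∀ r ∈ s, ∃ σ : Gal(E/k), σ (y : E) = r) :
      ∃ u : Eˣ, (u : E) = s.prod ∧ y ^ s.card / u ∈ U := by
    induction s using Multiset.induction with
    | empty => exact ⟨1, by simp, by simp⟩
    | cons r s ih =>
      obtain ⟨u, hu, hU⟩ := ih fun r hr => hs r (Multiset.mem_cons_of_mem hr)
      obtain ⟨σ, rfl⟩ := hs _ (Multiset.mem_cons_self _ _)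
      refine ⟨σ • y * u, by rw [Multiset.prod_cons, ← hu]; rfl, ?_⟩
      rw [Multiset.card_cons, pow_succ', mul_div_mul_comm]
      exact U.mul_mem (inv_div (σ • y) y ▸ U.inv_mem (h σ)) hU
  set p := minpoly k (y : E)
  have hsp : (p.map (algebraMap k E)).Splits := Normal.splits inferInstance _
  obtain ⟨u, hu, hU⟩ := key (p.map (algebraMap k E)).roots fun r hr => by
    have hr' := Polynomial.isRoot_of_mem_roots hr
    rw [Polynomial.IsRoot, Polynomial.eval_map_algebraMap] at hr'
    exact minpoly.exists_algEquiv_of_root' (Algebra.IsAlgebraic.isAlgebraic _) hr'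
  -- By Vieta, the product of the roots is the constant coefficient up to sign, hence comes from
  -- `k`.
  have hc := hsp.coeff_zero_eq_prod_roots_of_monic ((minpoly.monic hi).map _)
  have hb : algebraMap k E ((-1) ^ p.natDegree * p.coeff 0) = u := by
    rw [Polynomial.coeff_map, Polynomial.natDegree_map] at hc
    rw [map_mul, hc, hu, map_pow, map_neg, map_one, ← mul_assoc, ← mul_pow, neg_one_mul,
      neg_neg, one_pow, one_mul]
  refine ⟨(p.map (algebraMap k E)).roots.card, ?_, Units.mk0 ((-1) ^ p.natDegree * p.coeff 0) fun h0 => u.ne_zero ?_, ?_⟩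
  · rw [← hsp.natDegree_eq_card_roots, Polynomial.natDegree_map]
    exact minpoly.natDegree_pos hi
  · rw [← hb, h0, map_zero]
  · convert hU
    ext
    exact hb

/-- An integral closure is closed under taking roots. This lets unit conditions be checked after
raising to a power, where the elements involved come from the base field up to units. -/
theorem mem_integralUnits_of_pow {O : Type*} [CommRing O] [Algebra O E] {n : ℕ} (hn : 0 < n)
    {u : Eˣ} (h : u ^ n ∈ integralUnits O E) : u ∈ integralUnits O E := by
  rw [mem_integralUnits] at h ⊢
  rw [← inv_pow, Units.val_pow_eq_pow_val, Units.val_pow_eq_pow_val] at h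
  exact ⟨h.1.of_pow hn, h.2.of_pow hn⟩

end General

/-- Some positive power of a prime ideal of a ring with finite class group is principal. -/
theorem exists_valuation_eq {R F : Type*} [CommRing R] [IsDedekindDomain R] [Finite (ClassGroup R)]
    [Field F] [Algebra R F] [IsFractionRing R F] (v : HeightOneSpectrum R) :
    ∃ h : ℕ, 0 < h ∧ ∃ a : Fˣ, v.valuation F a = (WithZero.exp (-1 : ℤ)) ^ h ∧
      ∀ v' ≠ v, v'.valuation F (a : F) = 1 := by
  obtain ⟨h, hh, r, hr⟩ : ∃ h : ℕ, 0 < h ∧ ∃ r, v.asIdeal ^ h = Ideal.span {r} := by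
    -- The exponent `h` comes from the finite order of the class of `v` in the class group.
    let I : nonZeroDivisors (Ideal R) := ⟨v.asIdeal, mem_nonZeroDivisors_of_ne_zero v.ne_bot⟩
    obtain ⟨h, hh, h1⟩ := isOfFinOrder_iff_pow_eq_one.1 (isOfFinOrder_of_finite (ClassGroup.mk0 I))
    rw [← map_pow] at h1
    exact ⟨h, hh, ((ClassGroup.mk0_eq_one_iff (I ^ h).2).1 h1).principal⟩
  have hr0 : r ≠ 0 := by
    rintro rfl
    exact pow_ne_zero _ v.ne_bot (hr.trans (by simp))
  refine ⟨h, hh, Units.mk0 (algebraMap R F r)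
    ((map_ne_zero_iff _ (IsFractionRing.injective R F)).2 hr0), ?_, fun v' hv' => ?_⟩
  · rw [Units.val_mk0, HeightOneSpectrum.valuation_of_algebraMap,
      HeightOneSpectrum.intValuation_eq_exp_neg_multiplicity _ hr0, ← hr,
      multiplicity_pow_self v.ne_bot (Ideal.isUnit_iff.not.2 v.isPrime.ne_top), ← WithZero.exp_nsmul]
    simp
  · rw [Units.val_mk0, HeightOneSpectrum.valuation_of_algebraMap,
      HeightOneSpectrum.intValuation_eq_one_iff]
    -- If `v'` contained the generator `r`, it would contain `v^h`, hence `v`, and maximality would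
    -- force `v' = v`.
    intro hmem
    have hle : v.asIdeal ^ h ≤ v'.asIdeal := by
      rwa [hr, Ideal.span_singleton_le_iff_mem]
    have h2 := Ideal.IsPrime.le_of_pow_le hle
    exact hv' (HeightOneSpectrum.ext (v.isMaximal.eq_of_le v'.isPrime.ne_top h2).symm)

/-! ### Units of the completed base field at a finite place -/

section Adic

variable {F : Type*} [Field F] [NumberField F]

theorem map_mem_integralUnits_of_valued_eq_one {v : HeightOneSpectrum (𝓞 F)} {L : Type*} [Field L]
    [Algebra (v.adicCompletion F) L] [Algebra (v.adicCompletionIntegers F) L]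
    [IsScalarTower (v.adicCompletionIntegers F) (v.adicCompletion F) L]
    {b : (v.adicCompletion F)ˣ} (hb : Valued.v (b : v.adicCompletion F) = 1) :
    Units.map (algebraMap (v.adicCompletion F) L : v.adicCompletion F →* L) b ∈
      integralUnits (v.adicCompletionIntegers F) L := by
  have key (x : v.adicCompletion F) (hx : Valued.v x = 1) :
      IsIntegral (v.adicCompletionIntegers F) (algebraMap (v.adicCompletion F) L x) := by
    have := isIntegral_algebraMap (R := v.adicCompletionIntegers F) (A := L)
      (x := ⟨x, hx.le⟩)
    rwa [IsScalarTower.algebraMap_apply (v.adicCompletionIntegers F) (v.adicCompletion F) L] at this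
  rw [mem_integralUnits, ← map_inv]
  refine ⟨key _ hb, key _ ?_⟩
  rw [Units.val_inv_eq_inv_val, map_inv₀, hb, inv_one]

end Adic

/-! ### Surjectivity of localization over the algebraic closure -/

section Surjectivity

open scoped NumberField.LiesOver DirectSum

variable {F K : Type*} [Field F] [NumberField F] [Field K] [NumberField K] [Algebra F K]
  (D : Choices F K)

/-- This is Hilbert 90 itself, since the coefficients are the full multiplicative group.
Characteristic zero makes the algebraic closure Galois. -/
theorem eq_zero_of_infinitePlace (v : InfinitePlace F) (x : LocalH1Bar F (.inr v)) : x = 0 := by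
  have : CharZero v.Completion := charZero_of_injective_algebraMap (algebraMap F _).injective
  obtain ⟨y, hy, h⟩ := exists_eq_mk_divCocycle (k := v.Completion)
    (U := (⊤ : Subgroup (AlgebraicClosure v.Completion)ˣ)) x
  exact h.trans (mk_divCocycle_eq_zero hy trivial)

/-- Every class at a single finite place comes from a global class that is trivial at all other
places. -/
theorem exists_locBar_eq (v : HeightOneSpectrum (𝓞 F)) (x : LocalH1Bar F (.inl v)) :
    ∃ g, locBar D (.inl v) g = x ∧ ∀ v' ≠ v, locBar D (.inl v') g = 0 := by
  have : CharZero (v.adicCompletion F) :=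
    charZero_of_injective_algebraMap (algebraMap F _).injective
  obtain ⟨y, hy, hx⟩ := exists_eq_mk_divCocycle (k := v.adicCompletion F)
    (U := integralUnits (v.adicCompletionIntegers F) (AlgebraicClosure (v.adicCompletion F))) x
  obtain ⟨n, hn, b, hb⟩ := exists_pow_div_algebraMap_mem hy
  obtain ⟨h, hh, a, ha, ha'⟩ := exists_valuation_eq (F := F) v
  obtain ⟨m, hm⟩ : ∃ m : ℤ, Valued.v (b : v.adicCompletion F) = WithZero.exp m :=
    ⟨_, (WithZero.exp_log ((Valuation.ne_zero_iff _).2 b.ne_zero)).symm⟩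
  -- Since `a` has valuation `exp(-1)^h`, the power `a^(-m)` has valuation `exp(h * m)`, which is
  -- that of `b^h`. As `y^(n * h)` is `b^h` up to a unit, an `(n * h)`-th root of `a^(-m)` has the
  -- valuation of `y`.
  obtain ⟨z₀, hz₀⟩ := IsAlgClosed.exists_pow_nat_eq
    (algebraMap F (AlgebraicClosure F) (a ^ (-m) : Fˣ)) (Nat.mul_pos hn hh)
  have hz₀' : z₀ ≠ 0 := by
    rintro rfl
    rw [zero_pow (Nat.mul_pos hn hh).ne'] at hz₀
    exact (a ^ (-m)).ne_zero ((algebraMap F (AlgebraicClosure F)).injective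
      (hz₀.symm.trans (map_zero _).symm))
  let z := Units.mk0 z₀ hz₀'
  have hz : z ^ (n * h) = Units.map (algebraMap F (AlgebraicClosure F) : F →* _) (a ^ (-m)) :=
    Units.ext hz₀
  -- As `z^(n * h)` lies in `F`, the quotient `σ(z)/z` is a root of unity.
  have hzc (σ : Gal(AlgebraicClosure F/F)) : σ • z / z ∈ integralUnits ℤ (AlgebraicClosure F) := by
    refine mem_integralUnits_of_pow (Nat.mul_pos hn hh) ?_
    have : σ • z ^ (n * h) = z ^ (n * h) := by
      rw [hz]
      exact Units.ext (σ.commutes _)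
    rw [div_pow, ← smul_pow', this, div_self']
    exact one_mem _
  have hfz (v' : HeightOneSpectrum (𝓞 F)) :
      Units.map (D.finEmbBar v' : AlgebraicClosure F →* _) z ^ (n * h) =
        Units.map (algebraMap (v'.adicCompletion F) (AlgebraicClosure (v'.adicCompletion F)) :
          v'.adicCompletion F →* AlgebraicClosure (v'.adicCompletion F))
          (Units.map (algebraMap F (v'.adicCompletion F) : F →* _) (a ^ (-m))) := by
    rw [← map_pow, hz]
    ext
    exact ((D.finEmbBar v').commutes _).trans (IsScalarTower.algebraMap_apply F
      (v'.adicCompletion F) (AlgebraicClosure (v'.adicCompletion F)) _)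
  have hval (v' : HeightOneSpectrum (𝓞 F)) :
      Valued.v ((Units.map (algebraMap F (v'.adicCompletion F) : F →* _) (a ^ (-m)) :
        (v'.adicCompletion F)ˣ) : v'.adicCompletion F) = v'.valuation F (a : F) ^ (-m) := by
    refine (HeightOneSpectrum.valuedAdicCompletion_eq_valuation' v' _).trans ?_
    rw [Algebra.algebraMap_self_apply, Units.val_zpow_eq_zpow_val, map_zpow₀]
  refine ⟨H1.mk (divCocycle _ z hzc), ?_, fun v' hv' => ?_⟩
  · refine (map_mk_divCocycle (k' := v.adicCompletion F) (D.finEmbBar v)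
      (globalUnits_le_comap _ _) hzc hy ?_).trans hx.symm
    refine mem_integralUnits_of_pow (Nat.mul_pos hn hh) ?_
    rw [div_pow, hfz, pow_mul y]
    -- The power `(z/y)^(n * h)` is the quotient of the two units `a^(-m)/b^h` and `(y^n/b)^h`.
    have h1 := map_mem_integralUnits_of_valued_eq_one
      (L := AlgebraicClosure (v.adicCompletion F))
      (b := Units.map (algebraMap F (v.adicCompletion F) : F →* _) (a ^ (-m)) / b ^ h) (by
        rw [Units.val_div_eq_div_val, map_div₀, hval, ha, Units.val_pow_eq_pow_val, map_pow, hm,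
          ← WithZero.exp_nsmul, ← WithZero.exp_nsmul, ← WithZero.exp_zsmul, div_eq_one_iff_eq
          WithZero.exp_ne_zero]
        congr 1
        simp [mul_comm])
    have h2 := Subgroup.div_mem _ h1 (Subgroup.pow_mem _ hb h)
    rwa [map_div, div_pow, map_pow, div_div_div_cancel_right] at h2
  -- Away from `v`, `a` is a unit, hence so is the image of `z`; the comparison is with the trivial
  -- cocycle, `y = 1`.
  · refine (map_mk_divCocycle (k' := v'.adicCompletion F) (y := 1) (D.finEmbBar v')
      (globalUnits_le_comap _ _) hzc (fun σ => by simp) ?_).trans (mk_divCocycle_eq_zero _ (one_mem _))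
    refine mem_integralUnits_of_pow (Nat.mul_pos hn hh) ?_
    rw [div_one, hfz]
    refine map_mem_integralUnits_of_valued_eq_one ?_
    rw [hval, ha' v' hv', one_zpow]

/-- The image is a subgroup, so it suffices to reach elements supported at one place. At a finite
place `exists_locBar_eq` supplies a preimage; its infinite components vanish automatically. -/
theorem mapG_surjective : Function.Surjective (mapG D) := by
  classical
  intro s
  induction s using DirectSum.induction_on with
  | zero => exact ⟨0, map_zero _⟩
  | of v x =>
    rcases v with v | v
    · obtain ⟨g, hg, hg'⟩ := exists_locBar_eq D v x
      refine ⟨g, DFinsupp.ext fun v' => ?_⟩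
      change locBar D v' g = _
      rcases v' with v' | v'
      · by_cases hv : v' = v
        · subst hv
          rw [hg, DirectSum.of_eq_same]
        · rw [hg' v' hv, DirectSum.of_eq_of_ne _ _ _ fun h => hv (Sum.inl_injective h)]
      · rw [eq_zero_of_infinitePlace v' (locBar D _ g), DirectSum.of_eq_of_ne _ _ _ Sum.inr_ne_inl]
    · rw [eq_zero_of_infinitePlace v x]
      exact ⟨0, by simp⟩
  | add s t hs ht =>
    obtain ⟨a, rfl⟩ := hs
    obtain ⟨b, rfl⟩ := ht
    exact ⟨a + b, map_add _ _ _⟩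

end Surjectivity

end UnitCohomology

theorem mainTheorem6 (F K : Type*) [Field F] [NumberField F] [Field K] [NumberField K]
    [Algebra F K] [IsGalois F K] (D : UnitCohomology.Choices F K) :
    UnitCohomology.mapI D = 0 := by
  ext s
  -- Every element of the target lies in the range of `mapG`, so its class is zero.
  exact (QuotientAddGroup.eq_zero_iff _).2 (UnitCohomology.mapG_surjective D _)
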